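/- Let $P$ be an infinite field and let $\Theta=\mathrm{Com}\text{-}P$ be the variety of commutative associative unital $P$-algebras. Fix an infinite set $X^0$ of variables. For a finite $X\subset X^0$ let $W(X)=P[X]$ be the free algebra in $\Theta$ over $X$, and let $\Theta^0$ be the category with objects the $W(X)$ and morphisms all homomorphisms of $P$-algebras. For $H\in\Theta$, a system of equations $T\subseteq W(X)\times W(X)$ and a set $A\subseteq \mathrm{Hom}(W(X),H)$ put $$T'_H=\{\mu: W(X)\to H\mid T\subseteq \mathrm{Ker}\,\mu\},\qquad A'=\bigcap_{\mu\in A}\mathrm{Ker}\,\mu,\qquad T''_H=(T'_H)'.$$ The category $K_\Theta(H)$ of algebraic sets over $H$ has as objects the pairs $(X,A)$ with $A=T'_H$ for some $T$; its morphisms $(X,A)\to(Y,B)$ are the mappings $A\to B$ of the form $\nu\mapsto \nu s$ for a homomorphism $s:W(Y)\to W(X)$. The affine space functor $\iota_H:(\Theta^0)^{op}\to K_\Theta(H)$ sends $W(X)$ to $(X,\mathrm{Hom}(W(X),H))$ and $s$ to $\nu\mapsto\nu s$. Call a functor $F:K_\Theta(H_1)\to K_\Theta(H_2)$ monotone if $A_1\subseteq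 A_2$ implies $F(X,A_1)=(Y,B_1)$ and $F(X,A_2)=(Y,B_2)$ with the same $Y$ and $B_1\subseteq B_2$. A correct isomorphism is an isomorphism of categories $F:K_\Theta(H_1)\to K_\Theta(H_2)$ which is monotone and for which there is an automorphism $\varphi$ of $\Theta^0$ with $F\iota_{H_1}=\iota_{H_2}\varphi$. A correct equivalence is a pair of functors $F:K_\Theta(H_1)\to K_\Theta(H_2)$, $G:K_\Theta(H_2)\to K_\Theta(H_1)$ with $GF\approx 1$ and $FG\approx 1$, both monotone, for which there is an autoequivalence $(\varphi,\psi)$ of $\Theta^0$ (that is, $\psi\varphi\approx1$, $\varphi\psi\approx 1$) with $F\iota_{H_1}=\iota_{H_2}\varphi$ and $G\iota_{H_2}=\iota_{H_1}\psi$. Algebras $H_1,H_2\in\Theta$ are geometrically equivalent if $T''_{H_1}=T''_{H_2}$ for every finite $X\subset X^0$ and every system of equations $T$ in $W(X)$. For $\sigma\in\mathrm{Aut}(P)$ the twisted algebra $H^\sigma$ is the ring $H$ with the multiplication by scalars $\lambda\circ a=\sigma^{-1}(\lambda)\cdot a$. Theorem. For $H_1,H_2\in\Theta$ the following are equivalent: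 1. there is a correct isomorphism of the categories $K_\Theta(H_1)$ and $K_\Theta(H_2)$; 2. there is a correct equivalence of the categories $K_\Theta(H_1)$ and $K_\Theta(H_2)$; 3. $H_1$ and $H_2$ are twisted geometrically equivalent, i.e. $H_1^\sigma$ and $H_2$ are geometrically equivalent for some $\sigma\in\mathrm{Aut}(P)$. -/

import Mathlib

open CategoryTheory

namespace ComAlgGeom

universe u v w

/-- `W(X)`: the free commutative associative unital `P`-algebra over the finite set `X`
of variables, taken from the universe of variables `X₀`. -/
abbrev W (P : Type u) [Field P] {X₀ : Type w} (X : Finset X₀) : Type (max u w) :=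
  MvPolynomial X P

section Galois

variable {P : Type u} [Field P] {X₀ : Type w} {H : Type v} [CommRing H] [Algebra P H]

/-- `T'_H`: the points `μ : W(X) → H` that solve all the equations `w = w'` of the system `T`. -/
def zeros (H : Type v) [CommRing H] [Algebra P H] {X : Finset X₀}
    (T : Set (W P X × W P X)) : Set (W P X →ₐ[P] H) :=
  {μ | ∀ p ∈ T, μ p.1 = μ p.2}

/-- `A'_W`: the intersection of the kernel congruences of the points of `A`. -/
def equations {X : Finset X₀} (A : Set (W P X →ₐ[P] H)) : Set (W P X × W P X) :=
  {p | ∀ μ ∈ A, μ p.1 = μ p.2}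

/-- `T''_H`: the `H`-closure of a system of equations `T`. -/
def eqClosure (H : Type v) [CommRing H] [Algebra P H] {X : Finset X₀}
    (T : Set (W P X × W P X)) : Set (W P X × W P X) :=
  equations (zeros H T)

end Galois

/-- `H₁` and `H₂` are geometrically equivalent: `T''_{H₁} = T''_{H₂}` for every finite set `X`
of variables and every system of equations `T` in `W(X)`. -/
def GeometricallyEquivalent (P : Type u) [Field P] (X₀ : Type w)
    (H₁ : Type*) [CommRing H₁] [Algebra P H₁] (H₂ : Type*) [CommRing H₂] [Algebra P H₂] : Prop :=
  ∀ (X : Finset X₀) (T : Set (W P X × W P X)), eqClosure H₁ T = eqClosure H₂ T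

/-- The underlying ring of the twisted algebra `H^σ`. -/
def Twist {P : Type u} [Field P] (_σ : RingAut P) (H : Type v) : Type v := H

instance {P : Type u} [Field P] (σ : RingAut P) (H : Type v) [CommRing H] :
    CommRing (Twist σ H) :=
  inferInstanceAs (CommRing H)

/-- The scalar multiplication of `H^σ` is `l ∘ a = σ⁻¹(l) · a`. -/
instance {P : Type u} [Field P] (σ : RingAut P) (H : Type v) [CommRing H] [Algebra P H] :
    Algebra P (Twist σ H) :=
  ((algebraMap P H).comp (RingEquiv.symm σ : P ≃+* P).toRingHom).toAlgebra

theorem Twist.smul_def {P : Type u} [Field P] (σ : RingAut P) (H : Type v) [CommRing H]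
    [Algebra P H] (l : P) (a : H) :
    (l • (show Twist σ H from a) : Twist σ H) = (show Twist σ H from (σ⁻¹ : RingAut P) l • a) := by
  rw [Algebra.smul_def (A := H)]
  rfl

/-- `H₁` and `H₂` are twisted geometrically equivalent: `H₁^σ` and `H₂` are geometrically
equivalent for some automorphism `σ` of the field `P`. -/
def TwistedGeometricallyEquivalent (P : Type u) [Field P] (X₀ : Type w)
    (H₁ : Type*) [CommRing H₁] [Algebra P H₁] (H₂ : Type*) [CommRing H₂] [Algebra P H₂] : Prop :=
  ∃ σ : RingAut P, GeometricallyEquivalent P X₀ (Twist σ H₁) H₂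

/-- The objects `W(X)` of the category `Θ⁰` of free algebras. -/
structure FreeAlg (P : Type u) [Field P] (X₀ : Type w) where
  /-- the finite set of free generators -/
  X : Finset X₀

/-- The category `Θ⁰`: the morphisms are all the homomorphisms of `P`-algebras. -/
noncomputable instance (P : Type u) [Field P] (X₀ : Type w) : Category (FreeAlg P X₀) where
  Hom a b := W P a.X →ₐ[P] W P b.X
  id a := AlgHom.id P (W P a.X)
  comp f g := g.comp f

/-- The objects `(X, A)` of `K_Θ(H)`: `A` is an algebraic set in the affine space
`Hom(W(X), H)`. -/
structure AlgebraicSet (P : Type u) [Field P] (X₀ : Type w) (H : Type v) [CommRing H]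
    [Algebra P H] where
  /-- the finite set of variables -/
  X : Finset X₀
  /-- the set of points -/
  carrier : Set (W P X →ₐ[P] H)
  isAlgebraic : ∃ T : Set (W P X × W P X), carrier = zeros H T

section Categories

variable {P : Type u} [Field P] {X₀ : Type w} {H : Type v} [CommRing H] [Algebra P H]

/-- The morphisms `[s] : (X, A) → (Y, B)` of `K_Θ(H)`: the mappings `A → B` of the form
`ν ↦ ν s` for a homomorphism `s : W(Y) → W(X)`. -/
def AlgebraicSet.Hom (a b : AlgebraicSet P X₀ H) : Type (max u v w) :=
  {f : a.carrier → b.carrier //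
    ∃ s : W P b.X →ₐ[P] W P a.X, ∀ ν : a.carrier, (f ν).1 = ν.1.comp s}

/-- The category `K_Θ(H)` of algebraic sets over `H`. -/
instance : Category (AlgebraicSet P X₀ H) where
  Hom := AlgebraicSet.Hom
  id a := ⟨id, AlgHom.id P _, fun _ => rfl⟩
  comp f g := ⟨g.1 ∘ f.1, by
    obtain ⟨f, s, hs⟩ := f
    obtain ⟨g, t, ht⟩ := g
    refine ⟨s.comp t, fun ν => ?_⟩
    simp only [Function.comp_apply, ht, hs]
    rfl⟩

/-- `(X, A₁)` and `(X, A₂)` lie in the same affine space and `A₁ ⊆ A₂`. -/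
def AlgebraicSet.Sub (a b : AlgebraicSet P X₀ H) : Prop :=
  ∃ (X : Finset X₀) (A₁ A₂ : Set (W P X →ₐ[P] H)) (h₁ : ∃ T, A₁ = zeros H T)
    (h₂ : ∃ T, A₂ = zeros H T), a = ⟨X, A₁, h₁⟩ ∧ b = ⟨X, A₂, h₂⟩ ∧ A₁ ⊆ A₂

/-- The contravariant functor from `Θ⁰` to `K_Θ(H)` that sends `W(X)` to the affine space
`Hom(W(X), H)` and `s : W(Y) → W(X)` to the mapping `ν ↦ ν s`.
Its image is the category `K⁰_Θ(H)` of affine spaces, a full subcategory of `K_Θ(H)`. -/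
noncomputable def affine (P : Type u) [Field P] (X₀ : Type w) (H : Type v) [CommRing H] [Algebra P H] :
    (FreeAlg P X₀)ᵒᵖ ⥤ AlgebraicSet P X₀ H where
  obj a := ⟨a.unop.X, Set.univ, ∅, by simp [zeros]⟩
  map {_ _} s := ⟨fun ν => ⟨AlgHom.comp ν.1 s.unop, trivial⟩, s.unop, fun _ => rfl⟩

end Categories

section Correctness

variable (P : Type u) [Field P] (X₀ : Type w)
  (H₁ : Type*) [CommRing H₁] [Algebra P H₁] (H₂ : Type*) [CommRing H₂] [Algebra P H₂]

/-- There is a correct isomorphism `F : K_Θ(H₁) → K_Θ(H₂)` (with inverse `G`): `F` restricts to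
an isomorphism between the categories of affine spaces which comes from an automorphism `φ`
(with inverse `ψ`) of `Θ⁰`, and `F` respects inclusions of algebraic sets in the same
affine space. -/
def CorrectlyIsomorphic : Prop :=
  ∃ (F : AlgebraicSet P X₀ H₁ ⥤ AlgebraicSet P X₀ H₂)
    (G : AlgebraicSet P X₀ H₂ ⥤ AlgebraicSet P X₀ H₁),
    F ⋙ G = 𝟭 _ ∧ G ⋙ F = 𝟭 _ ∧
    (∃ φ ψ : FreeAlg P X₀ ⥤ FreeAlg P X₀, φ ⋙ ψ = 𝟭 _ ∧ ψ ⋙ φ = 𝟭 _ ∧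
      affine P X₀ H₁ ⋙ F = φ.op ⋙ affine P X₀ H₂) ∧
    (∀ a b, a.Sub b → (F.obj a).Sub (F.obj b))

/-- There is a correct equivalence `(F, G)` of `K_Θ(H₁)` and `K_Θ(H₂)`: `F` and `G` restrict to
functors between the categories of affine spaces which come from an autoequivalence `(φ, ψ)`
of `Θ⁰`, and `F` and `G` respect inclusions of algebraic sets in the same affine space. -/
def CorrectlyEquivalent : Prop :=
  ∃ (F : AlgebraicSet P X₀ H₁ ⥤ AlgebraicSet P X₀ H₂)
    (G : AlgebraicSet P X₀ H₂ ⥤ AlgebraicSet P X₀ H₁),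
    Nonempty (F ⋙ G ≅ 𝟭 _) ∧ Nonempty (G ⋙ F ≅ 𝟭 _) ∧
    (∃ φ ψ : FreeAlg P X₀ ⥤ FreeAlg P X₀,
      Nonempty (φ ⋙ ψ ≅ 𝟭 _) ∧ Nonempty (ψ ⋙ φ ≅ 𝟭 _) ∧
      affine P X₀ H₁ ⋙ F = φ.op ⋙ affine P X₀ H₂ ∧
      affine P X₀ H₂ ⋙ G = ψ.op ⋙ affine P X₀ H₁) ∧
    (∀ a b, a.Sub b → (F.obj a).Sub (F.obj b)) ∧
    (∀ a b, a.Sub b → (G.obj a).Sub (G.obj b))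

end Correctness

end ComAlgGeom

/-!
Conditions 1 and 2 both provide an equivalence `F` of the categories of algebraic sets and an
autoequivalence `φ` of `Θ⁰` with `F ι₁ = ι₂ φ`; nothing else is needed for condition 3.

The first ingredient is that `φ` is semi-inner (`exists_semilinear_isElementMap`). The free algebra
on one generator is a retract of every free algebra except the initial one, and this characterizes
it, so `φ` preserves it. Hence elements of `W(X)`, viewed as homomorphisms `W(x) → W(X)`, are
carried by bijections `Φ : W(X) → W(φ X)` which conjugate polynomial operations to polynomial
operations. On the scalars `P = W(∅)`, normalized so as to fix `0` and `1`, the bijection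
conjugates a translation to a polynomial map with a polynomial inverse, hence to an affine map; a
short computation shows that it is additive, and multiplicative by the same argument applied to
homotheties. Since `P` is infinite, the polynomials conjugate to `x + y` and `x * y` are then
`x + y` and `x * y`, so every `Φ` is an isomorphism of rings and acts on `P` by an automorphism `σ`.

The second ingredient is that the closed congruences on `W(X)` are those of the form
`{(w, w') | ι(w) k = ι(w') k}` for a morphism `k` of an algebraic set into the affine space of
`X`. As `F` is full, faithful and essentially surjective, `Φ` identifies the `H₁`-closed
congruences with the `H₂`-closed ones (`IsElementMap.eqClosure_mapSystem`). Up to an isomorphism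
of `P`-algebras `Φ` is the coefficient map of `σ`, and a homomorphism into `H₁^σ` is a
homomorphism into `H₁` with twisted coefficients (`eqClosure_twist`), whence condition 3.

Conversely, if `σ` matches closures over `H₁` with closures over `H₂`, then `twistFunctor σ`, which
sends an algebraic set to the solutions of its `σ`-twisted equations, is a correct isomorphism whose
inverse `twistFunctor σ⁻¹` has the same form, so the pair is also a correct equivalence.
-/

namespace ComAlgGeom

universe u w

/-! ### Bijections of a field that conjugate the ring operations to polynomial maps -/

section Field

open Polynomial

variable {P : Type*} [Field P] [Infinite P]

theorem exists_affine_of_eval_eval {p q : P[X]} (h : ∀ x, p.eval (q.eval x) = x) :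
    ∃ a b : P, a ≠ 0 ∧ ∀ x, p.eval x = a * x + b := by
  have hc : p.comp q = X := Polynomial.funext fun x => by simp [h]
  have hd : p.natDegree = 1 := by
    have := congrArg natDegree hc
    rw [natDegree_comp, natDegree_X] at this
    exact Nat.eq_one_of_mul_eq_one_right this
  refine ⟨p.coeff 1, p.coeff 0, ?_, fun x => ?_⟩
  · rw [← hd]
    exact leadingCoeff_ne_zero.2 fun h0 => by simp [h0] at hd
  · conv_lhs => rw [eq_X_add_C_of_natDegree_le_one hd.le]
    simp

/-- Translations are conjugated to invertible polynomial maps, hence to affine maps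
`x ↦ A b * x + α b`. Commutativity of addition forces `A b = 1 + c * α b`, and `c = 0` because
`A` has no zero. -/
theorem map_add_of_conj_polynomial {α : P → P} (hα : Function.Bijective α) (h0 : α 0 = 0)
    (h1 : α 1 = 1) (h : ∀ b, ∃ p : P[X], ∀ a, α (a + b) = p.eval (α a)) (a b : P) :
    α (a + b) = α a + α b := by
  have key : ∀ b, ∃ A : P, A ≠ 0 ∧ ∀ a, α (a + b) = A * α a + α b := fun b => by
    obtain ⟨p, hp⟩ := h b
    obtain ⟨q, hq⟩ := h (-b)
    obtain ⟨A, B, hA, hAB⟩ := exists_affine_of_eval_eval (p := p) (q := q) fun x => by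
      obtain ⟨y, rfl⟩ := hα.2 x
      rw [← hq, ← hp, neg_add_cancel_right]
    refine ⟨A, hA, fun a => ?_⟩
    have hB := hp 0
    rw [hAB, h0, mul_zero, zero_add, zero_add] at hB
    rw [hp, hAB, hB]
  choose A hA hA' using key
  have hlin : ∀ b, A b = 1 + (A 1 - 1) * α b := fun b => by
    have e := hA' b 1
    rw [add_comm, hA' 1 b, h1] at e
    linear_combination -e
  have hc : A 1 - 1 = 0 := by
    by_contra hc
    obtain ⟨b, hb⟩ := hα.2 (-(A 1 - 1)⁻¹)
    refine hA b ?_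
    rw [hlin, hb]
    field_simp
    ring
  rw [hA', hlin, hc]
  ring

theorem map_mul_of_conj_polynomial {α : P → P} (hα : Function.Bijective α) (h0 : α 0 = 0)
    (h1 : α 1 = 1) (h : ∀ b, ∃ p : P[X], ∀ a, α (a * b) = p.eval (α a)) (a b : P) :
    α (a * b) = α a * α b := by
  rcases eq_or_ne b 0 with rfl | hb
  · simp [h0]
  obtain ⟨p, hp⟩ := h b
  obtain ⟨q, hq⟩ := h b⁻¹
  obtain ⟨A, B, -, hAB⟩ := exists_affine_of_eval_eval (p := p) (q := q) fun x => by
    obtain ⟨y, rfl⟩ := hα.2 x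
    rw [← hq, ← hp, inv_mul_cancel_right₀ hb]
  have hB := hp 0
  rw [hAB, h0, zero_mul, h0, mul_zero, zero_add] at hB
  have hA' := hp 1
  rw [hAB, h1, one_mul, ← hB] at hA'
  rw [hp, hAB, ← hB, hA']
  ring

end Field

/-! ### Autoequivalences of the category of free algebras -/

section FreeAlg

open MvPolynomial

variable {P : Type u} [Field P] {X₀ : Type w}

/-- A morphism of `Θ⁰` as a homomorphism of `P`-algebras. -/
abbrev FreeAlg.toAlgHom {a b : FreeAlg P X₀} (s : a ⟶ b) : W P a.X →ₐ[P] W P b.X := s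

/-- A homomorphism of free algebras as a morphism of `Θ⁰`. -/
abbrev FreeAlg.ofAlgHom {a b : FreeAlg P X₀} (s : W P a.X →ₐ[P] W P b.X) : a ⟶ b := s

open FreeAlg (toAlgHom ofAlgHom)

theorem FreeAlg.subsingleton_end_iff (a : FreeAlg P X₀) : Subsingleton (a ⟶ a) ↔ a.X = ∅ := by
  constructor
  · intro h
    by_contra hne
    obtain ⟨i, hi⟩ := Finset.nonempty_iff_ne_empty.2 hne
    have e : ofAlgHom (aeval fun _ => 0) = 𝟙 a := Subsingleton.elim _ _
    have := congrArg (fun s => toAlgHom s (MvPolynomial.X ⟨i, hi⟩)) e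
    simp only [toAlgHom, ofAlgHom] at this
    erw [aeval_X] at this
    exact X_ne_zero _ this.symm
  · intro h
    have : IsEmpty a.X := by rw [h]; infer_instance
    exact ⟨fun s t => MvPolynomial.algHom_ext (f := toAlgHom s) (g := toAlgHom t)
      fun i => isEmptyElim i⟩

theorem FreeAlg.obj_X_eq_empty_iff (φ : FreeAlg P X₀ ⥤ FreeAlg P X₀) [φ.Full] [φ.Faithful]
    (a : FreeAlg P X₀) : (φ.obj a).X = ∅ ↔ a.X = ∅ := by
  rw [← FreeAlg.subsingleton_end_iff, ← FreeAlg.subsingleton_end_iff]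
  exact (Functor.FullyFaithful.ofFullyFaithful φ).homEquiv.symm.subsingleton_congr

/-- If `X` is nonempty, a surjection onto `W(X)` from a polynomial ring in one variable is injective,
since otherwise the generators of `W(X)` would be algebraic over `P`. -/
theorem bijective_of_surjective_polynomial {X : Finset X₀} (hX : X.Nonempty)
    (r : Polynomial P →ₐ[P] W P X) (hr : Function.Surjective r) : Function.Bijective r := by
  refine ⟨?_, hr⟩
  obtain ⟨i, hi⟩ := hX
  rw [injective_iff_map_eq_zero]
  intro f hf
  by_contra hne
  have halg : IsAlgebraic P (r Polynomial.X) :=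
    ⟨f, hne, by rw [← hf, Polynomial.aeval_algHom_apply, Polynomial.aeval_X_left_apply]⟩
  obtain ⟨p, hp⟩ := hr (MvPolynomial.X ⟨i, hi⟩)
  refine transcendental_X P (⟨i, hi⟩ : X) ?_
  rw [← hp, ← Polynomial.aeval_X_left_apply p, ← Polynomial.aeval_algHom_apply]
  exact Algebra.isAlgebraic_adjoin_singleton_iff.mpr halg _
    (Polynomial.aeval_mem_adjoin_singleton P _)

/-- A family of bijections `W(X) → W(φ X)` which turns the action of the homomorphisms `s` of free
algebras on elements into that of the `φ s`. -/
structure IsElementMap (φ : FreeAlg P X₀ ⥤ FreeAlg P X₀)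
    (Φ : ∀ a : FreeAlg P X₀, W P a.X → W P (φ.obj a).X) : Prop where
  bijective : ∀ a, Function.Bijective (Φ a)
  map_apply : ∀ {a b : FreeAlg P X₀} (s : a ⟶ b) (w : W P a.X),
    Φ b (toAlgHom s w) = toAlgHom (φ.map s) (Φ a w)

/-- An equivalence `φ` preserves the free algebra on one generator, because this is the retract of
all the free algebras except the initial one. Elements of `W(X)` are homomorphisms from it. -/
theorem exists_isElementMap [Nonempty X₀] (φ : FreeAlg P X₀ ⥤ FreeAlg P X₀) [φ.IsEquivalence] :
    ∃ Φ, IsElementMap φ Φ := by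
  classical
  obtain ⟨x⟩ := ‹Nonempty X₀›
  let I : FreeAlg P X₀ := ⟨{x}⟩
  let x' : I.X := ⟨x, Finset.mem_singleton_self x⟩
  have hsub : ∀ i : I.X, i = x' := fun i => Subtype.ext (Finset.mem_singleton.1 i.2)
  have hI : I.X ≠ ∅ := Finset.singleton_ne_empty x
  let I' := φ.objPreimage I
  have hI' : I'.X ≠ ∅ := fun h => hI <| by
    refine (FreeAlg.subsingleton_end_iff I).1
      ((φ.objObjPreimageIso I).conj.toEquiv.subsingleton_congr.1 ?_)
    exact (FreeAlg.subsingleton_end_iff _).2 ((FreeAlg.obj_X_eq_empty_iff φ I').2 h)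
  obtain ⟨y, hy⟩ := Finset.nonempty_iff_ne_empty.2 hI'
  let ι : I ⟶ I' := ofAlgHom (aeval fun _ => X ⟨y, hy⟩)
  let ρ : I' ⟶ I := ofAlgHom (aeval fun _ => X x')
  have hιρ : ι ≫ ρ = 𝟙 I := by
    refine MvPolynomial.algHom_ext (f := toAlgHom (ι ≫ ρ)) (g := toAlgHom (𝟙 I)) fun i => ?_
    change aeval _ (aeval _ (X i)) = X i
    rw [aeval_X, aeval_X, hsub i]
  -- `φ I` is a retract of `φ I' ≅ I`, so it is generated by one element
  let r : I ⟶ φ.obj I := (φ.objObjPreimageIso I).inv ≫ φ.map ρ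
  have hr : ∀ v, ∃ u, toAlgHom r u = v := fun v => by
    refine ⟨toAlgHom (φ.map ι ≫ (φ.objObjPreimageIso I).hom) v, ?_⟩
    have e : (φ.map ι ≫ (φ.objObjPreimageIso I).hom) ≫ r = 𝟙 _ := by
      simp [r, ← φ.map_comp, hιρ]
    exact congrArg (fun s => toAlgHom s v) e
  let q : Polynomial P →ₐ[P] W P I.X := Polynomial.aeval (X x')
  have hq : Function.Surjective q := fun u =>
    ⟨aeval (fun _ => Polynomial.X) u, by
      have : q.comp (aeval fun _ => Polynomial.X) = AlgHom.id P _ :=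
        MvPolynomial.algHom_ext fun i => by simp [q, hsub i]
      exact congrArg (fun s => s u) this⟩
  have hbij := bijective_of_surjective_polynomial
    (Finset.nonempty_iff_ne_empty.2 fun h => hI ((FreeAlg.obj_X_eq_empty_iff φ I).1 h))
    ((toAlgHom r).comp q) (Function.Surjective.comp (g := toAlgHom r) hr hq)
  let e := AlgEquiv.ofBijective _ hbij
  -- `Φ w` is the value of `φ (x ↦ w)` at the generator of `W(φ I)`
  let ev (a : FreeAlg P X₀) (w : W P a.X) : I ⟶ a := ofAlgHom (aeval fun _ => w)
  have hev : ∀ a w, toAlgHom (ev a w) (X x') = w := fun a w => aeval_X _ _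
  refine ⟨fun a w => toAlgHom (φ.map (ev a w)) (e Polynomial.X), fun a => ⟨?_, ?_⟩, ?_⟩
  · intro w w' h
    have h2 : (toAlgHom (φ.map (ev a w))).comp e.toAlgHom
        = (toAlgHom (φ.map (ev a w'))).comp e.toAlgHom := Polynomial.algHom_ext h
    have h3 : φ.map (ev a w) = φ.map (ev a w') := by
      refine AlgHom.ext fun v => ?_
      obtain ⟨p, rfl⟩ := e.surjective v
      exact congrArg (fun s => s p) h2
    rw [← hev a w, φ.map_injective h3, hev]
  · intro v
    let t : φ.obj I ⟶ φ.obj a := ofAlgHom ((Polynomial.aeval v).comp e.symm.toAlgHom)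
    refine ⟨toAlgHom (φ.preimage t) (X x'), ?_⟩
    have : ev a (toAlgHom (φ.preimage t) (X x')) = φ.preimage t := by
      refine MvPolynomial.algHom_ext (f := toAlgHom (ev a _)) (g := toAlgHom _) fun i => ?_
      rw [hsub i, hev]
    dsimp only
    rw [this, φ.map_preimage]
    change Polynomial.aeval v (e.symm (e Polynomial.X)) = v
    simp
  · intro a b s w
    have : ev b (toAlgHom s w) = ev a w ≫ s := by
      refine MvPolynomial.algHom_ext (f := toAlgHom (ev b _)) (g := toAlgHom _) fun i => ?_
      rw [hsub i, hev]
      exact congrArg (toAlgHom s) (hev a w).symm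
    rw [this, φ.map_comp]
    rfl

namespace IsElementMap

variable {φ : FreeAlg P X₀ ⥤ FreeAlg P X₀} [φ.IsEquivalence]
  {Φ : ∀ a : FreeAlg P X₀, W P a.X → W P (φ.obj a).X}

/-- The images of the free generators of `W(Z)` generate `W(φ Z)`. -/
theorem exists_aeval_eq (h : IsElementMap φ Φ) (Z : FreeAlg P X₀) (v : W P (φ.obj Z).X) :
    ∃ F : W P Z.X, aeval (fun i => Φ Z (X i)) F = v := by
  let Z' := φ.objPreimage Z
  let η := φ.objObjPreimageIso Z
  have hη : ∀ u, toAlgHom η.hom (toAlgHom η.inv u) = u := fun u =>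
    congrArg (fun s => toAlgHom s u) η.inv_hom_id
  -- `θ` sends the `Φ(xᵢ)` to the generators of `W(Z)`; it exists because `W(Z)` is isomorphic to
  -- some `W(φ Z')`, all of whose elements are values of `Φ`
  have hs : ∀ i : Z.X, ∃ c : W P Z'.X, Φ Z' c = toAlgHom η.inv (X i) :=
    fun i => (h.bijective Z').2 _
  choose c hc using hs
  let s : Z ⟶ Z' := ofAlgHom (aeval c)
  let θ : φ.obj Z ⟶ Z := φ.map s ≫ η.hom
  let κ : Z ⟶ φ.obj Z := ofAlgHom (aeval fun i => Φ Z (X i))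
  have hθ : ∀ i, toAlgHom θ (Φ Z (X i)) = X i := fun i => by
    change toAlgHom η.hom (toAlgHom (φ.map s) (Φ Z (X i))) = X i
    rw [← h.map_apply]
    change toAlgHom η.hom (Φ Z' (aeval c (X i))) = X i
    rw [aeval_X, hc, hη]
  have hfix : ∀ i, toAlgHom (θ ≫ κ) (Φ Z (X i)) = Φ Z (X i) := fun i => by
    change toAlgHom κ (toAlgHom θ (Φ Z (X i))) = _
    rw [hθ]
    exact aeval_X _ _
  -- by fullness `θ ≫ κ` is the image of an endomorphism of `W(Z)` which fixes the generators
  have hid : φ.preimage (θ ≫ κ) = 𝟙 Z := by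
    refine MvPolynomial.algHom_ext (f := toAlgHom _) (g := toAlgHom (𝟙 Z)) fun i => ?_
    apply (h.bijective Z).1
    rw [h.map_apply, φ.map_preimage, hfix]
    rfl
  have hid' : θ ≫ κ = 𝟙 _ := by
    rw [← φ.map_preimage (θ ≫ κ), hid, φ.map_id]
  exact ⟨toAlgHom θ v, congrArg (fun s => toAlgHom s v) hid'⟩

theorem algHom_ext (h : IsElementMap φ Φ) {Z : FreeAlg P X₀} {A : Type*} [CommRing A]
    [Algebra P A] {f g : W P (φ.obj Z).X →ₐ[P] A}
    (hfg : ∀ i, f (Φ Z (X i)) = g (Φ Z (X i))) : f = g := by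
  refine AlgHom.ext fun v => ?_
  obtain ⟨F, rfl⟩ := h.exists_aeval_eq Z v
  rw [comp_aeval_apply, comp_aeval_apply]
  simp only [hfg]

/-- The family `Φ` conjugates polynomial operations to polynomial operations. -/
theorem exists_conj [Infinite X₀] (h : IsElementMap φ Φ) {n : ℕ} (w : MvPolynomial (Fin n) P) :
    ∃ F : MvPolynomial (Fin n) P, ∀ (a : FreeAlg P X₀) (f : Fin n → W P a.X),
      Φ a (aeval f w) = aeval (fun i => Φ a (f i)) F := by
  obtain ⟨Z, hZ⟩ := Infinite.exists_subset_card_eq X₀ n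
  let e : Z ≃ Fin n := Z.equivFinOfCardEq hZ
  obtain ⟨F, hF⟩ := h.exists_aeval_eq ⟨Z⟩ (Φ ⟨Z⟩ (rename e.symm w))
  refine ⟨rename e F, fun a f => ?_⟩
  let s : (⟨Z⟩ : FreeAlg P X₀) ⟶ a := ofAlgHom (aeval fun i => f (e i))
  have hs : toAlgHom s (rename e.symm w) = aeval f w := by
    change aeval _ (rename e.symm w) = _
    rw [aeval_rename]
    congr 2
    ext i
    simp
  have hsX : ∀ i, toAlgHom s (X i) = f (e i) := fun i => aeval_X _ _
  rw [← hs, h.map_apply, ← hF, comp_aeval_apply, aeval_rename]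
  simp only [← h.map_apply, hsX]
  rfl

/-- Composing with an affine map, which is an automorphism of `P[x]`, makes `Φ` fix `0` and `1`. -/
theorem exists_normalized (h : IsElementMap φ Φ) :
    ∃ Ψ, IsElementMap φ Ψ ∧ Ψ ⟨∅⟩ 0 = 0 ∧ Ψ ⟨∅⟩ 1 = 1 := by
  have hE : IsEmpty (φ.obj ⟨∅⟩).X := by rw [(FreeAlg.obj_X_eq_empty_iff φ ⟨∅⟩).2 rfl]; infer_instance
  obtain ⟨c₀, h₀⟩ := C_surjective (R := P) (φ.obj ⟨∅⟩).X (Φ ⟨∅⟩ 0)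
  obtain ⟨c₁, h₁⟩ := C_surjective (R := P) (φ.obj ⟨∅⟩).X (Φ ⟨∅⟩ 1)
  have hne : c₁ - c₀ ≠ 0 := fun e => by
    rw [sub_eq_zero.1 e, h₀] at h₁
    exact zero_ne_one ((h.bijective _).1 h₁)
  refine ⟨fun a w => C (c₁ - c₀)⁻¹ * (Φ a w - C c₀), ⟨fun a => ⟨fun w w' e => ?_, fun v => ?_⟩,
    fun {a b} s w => ?_⟩, ?_, ?_⟩
  · have hC : (C (c₁ - c₀)⁻¹ : W P (φ.obj a).X) ≠ 0 := by simpa using hne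
    exact (h.bijective a).1 (sub_left_injective (mul_left_cancel₀ hC e))
  · obtain ⟨w, hw⟩ := (h.bijective a).2 (C (c₁ - c₀) * v + C c₀)
    refine ⟨w, ?_⟩
    dsimp only
    rw [hw, add_sub_cancel_right, ← mul_assoc, ← C_mul, inv_mul_cancel₀ hne, C_1, one_mul]
  · rw [h.map_apply, map_mul, map_sub]
    congr 2
    · exact ((toAlgHom (φ.map s)).commutes _).symm
    · exact ((toAlgHom (φ.map s)).commutes c₀).symm
  · simp [h₀]
  · dsimp only
    rw [← h₁, ← C_sub, ← C_mul, inv_mul_cancel₀ hne, C_1]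

end IsElementMap

/-- Every autoequivalence of `Θ⁰` is semi-inner: it is induced by isomorphisms of rings
`W(X) ≃ W(φ X)` that act on the scalars by one automorphism `σ` of `P`. -/
theorem exists_semilinear_isElementMap [Infinite P] [Infinite X₀]
    (φ : FreeAlg P X₀ ⥤ FreeAlg P X₀) [φ.IsEquivalence] :
    ∃ (σ : RingAut P) (Φ : ∀ a : FreeAlg P X₀, W P a.X ≃+* W P (φ.obj a).X),
      IsElementMap φ (fun a => Φ a) ∧ ∀ a c, Φ a (C c) = C (σ c) := by
  obtain ⟨Φ₀, hΦ₀⟩ := exists_isElementMap φ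
  obtain ⟨Φ, h, h0, h1⟩ := hΦ₀.exists_normalized
  have hE : IsEmpty (φ.obj ⟨∅⟩).X := by rw [(FreeAlg.obj_X_eq_empty_iff φ ⟨∅⟩).2 rfl]; infer_instance
  have hα : ∀ c : P, ∃ d : P, C d = Φ ⟨∅⟩ (C c) := fun c => C_surjective _ _
  choose α hα using hα
  have hΦC : ∀ a c, Φ a (C c) = C (α c) := fun a c => by
    let s : (⟨∅⟩ : FreeAlg P X₀) ⟶ a := ofAlgHom (aeval fun i => isEmptyElim i)
    have hs : toAlgHom s (C c) = C c := (toAlgHom s).commutes c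
    rw [← hs, h.map_apply, ← hα]
    exact (toAlgHom (φ.map s)).commutes _
  have hbij : Function.Bijective α := by
    constructor
    · intro c d e
      apply C_injective (∅ : Finset X₀) P
      apply (h.bijective ⟨∅⟩).1
      rw [← hα, ← hα, e]
    · intro d
      obtain ⟨w, hw⟩ := (h.bijective ⟨∅⟩).2 (C d)
      obtain ⟨c, rfl⟩ := C_surjective (R := P) (∅ : Finset X₀) w
      rw [← hα] at hw
      exact ⟨c, C_injective _ P hw⟩
  have hα0 : α 0 = 0 := C_injective (φ.obj ⟨∅⟩).X P (by rw [hα, C_0, h0, C_0])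
  have hα1 : α 1 = 1 := C_injective (φ.obj ⟨∅⟩).X P (by rw [hα, C_1, h1, C_1])
  have heval : ∀ {w F : MvPolynomial (Fin 2) P},
      (∀ (a : FreeAlg P X₀) (f : Fin 2 → W P a.X),
        Φ a (aeval f w) = aeval (fun i => Φ a (f i)) F) →
      ∀ f : Fin 2 → P, α (eval f w) = eval (fun i => α (f i)) F := fun {w F} hF f => by
    have e := hF ⟨∅⟩ (fun i => C (f i))
    have hC : ∀ (b : FreeAlg P X₀) (g : Fin 2 → P) (p : MvPolynomial (Fin 2) P),
        aeval (fun i => (C (g i) : W P b.X)) p = C (eval g p) := fun b g p => by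
      have := aeval_algebraMap_apply (W P b.X) g p
      rw [aeval_eq_eval] at this
      exact this
    simp only [hΦC, hC] at e
    exact C_injective _ P e
  have hpoly : ∀ {F : MvPolynomial (Fin 2) P} (b : P), ∃ p : Polynomial P,
      ∀ x, p.eval x = eval ![x, b] F := fun {F} b => by
    refine ⟨aeval ![Polynomial.X, Polynomial.C b] F, fun x => ?_⟩
    rw [← Polynomial.coe_aeval_eq_eval, comp_aeval_apply, ← aeval_eq_eval]
    congr 2
    ext i
    fin_cases i <;> simp
  have hvec : ∀ a b : P, (fun i => α (![a, b] i)) = ![α a, α b] := fun a b => by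
    ext i
    fin_cases i <;> rfl
  obtain ⟨F, hF⟩ := h.exists_conj (X 0 + X 1 : MvPolynomial (Fin 2) P)
  obtain ⟨M, hM⟩ := h.exists_conj (X 0 * X 1 : MvPolynomial (Fin 2) P)
  have hF' : ∀ a b, α (a + b) = eval ![α a, α b] F := fun a b => by
    simpa [hvec] using heval hF ![a, b]
  have hM' : ∀ a b, α (a * b) = eval ![α a, α b] M := fun a b => by
    simpa [hvec] using heval hM ![a, b]
  have hadd := map_add_of_conj_polynomial hbij hα0 hα1 fun b => by
    obtain ⟨p, hp⟩ := hpoly (F := F) (α b)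
    exact ⟨p, fun a => by rw [hp, hF']⟩
  have hmul := map_mul_of_conj_polynomial hbij hα0 hα1 fun b => by
    obtain ⟨p, hp⟩ := hpoly (F := M) (α b)
    exact ⟨p, fun a => by rw [hp, hM']⟩
  -- the operations coincide on `P`, so the polynomials coincide since `P` is infinite
  have hFeq : F = X 0 + X 1 := MvPolynomial.funext fun f => by
    obtain ⟨a, ha⟩ := hbij.2 (f 0)
    obtain ⟨b, hb⟩ := hbij.2 (f 1)
    have hf : f = ![α a, α b] := by ext i; fin_cases i <;> simp [ha, hb]
    rw [hf, ← hF', hadd]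
    simp
  have hMeq : M = X 0 * X 1 := MvPolynomial.funext fun f => by
    obtain ⟨a, ha⟩ := hbij.2 (f 0)
    obtain ⟨b, hb⟩ := hbij.2 (f 1)
    have hf : f = ![α a, α b] := by ext i; fin_cases i <;> simp [ha, hb]
    rw [hf, ← hM', hmul]
    simp
  have hΦadd : ∀ a (p q : W P a.X), Φ a (p + q) = Φ a p + Φ a q := fun a p q => by
    simpa [hFeq] using hF a ![p, q]
  have hΦmul : ∀ a (p q : W P a.X), Φ a (p * q) = Φ a p * Φ a q := fun a p q => by
    simpa [hMeq] using hM a ![p, q]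
  refine ⟨{ Equiv.ofBijective α hbij with map_add' := hadd, map_mul' := hmul },
    fun a => { Equiv.ofBijective (Φ a) (h.bijective a) with
      map_add' := hΦadd a, map_mul' := hΦmul a }, h, hΦC⟩

end FreeAlg

/-! ### Closed congruences and their transport along isomorphisms -/

section Galois

variable {P : Type u} [Field P] {X₀ : Type w} {H : Type*} [CommRing H] [Algebra P H]
  {H' : Type*} [CommRing H'] [Algebra P H'] {X Y : Finset X₀}

theorem subset_eqClosure (T : Set (W P X × W P X)) : T ⊆ eqClosure H T :=
  fun p hp _ hμ => hμ p hp

theorem eqClosure_subset_equations {T : Set (W P X × W P X)} {A : Set (W P X →ₐ[P] H)}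
    (h : T ⊆ equations A) : eqClosure H T ⊆ equations A :=
  fun _ hp μ hμ => hp μ fun _ hq => h hq μ hμ

theorem eqClosure_equations (A : Set (W P X →ₐ[P] H)) :
    eqClosure H (equations A) = equations A :=
  (eqClosure_subset_equations subset_rfl).antisymm (subset_eqClosure _)

theorem zeros_equations_zeros (T : Set (W P X × W P X)) :
    zeros H (equations (zeros H T)) = zeros H T :=
  Set.Subset.antisymm (fun _ hμ p hp => hμ p (subset_eqClosure T hp))
    fun μ hμ _ hp => hp μ hμ

/-- The image of a system of equations under a map applied to both sides. -/
def mapSystem (e : W P X → W P Y) (T : Set (W P X × W P X)) : Set (W P Y × W P Y) :=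
  Prod.map e e '' T

theorem mk_mem_mapSystem {e : W P X → W P Y} (he : Function.Injective e)
    {T : Set (W P X × W P X)} {w w' : W P X} : (e w, e w') ∈ mapSystem e T ↔ (w, w') ∈ T :=
  (he.prodMap he).mem_set_image (a := (w, w'))

theorem mapSystem_subset_iff {e : W P X → W P Y} {T : Set (W P X × W P X)}
    {S : Set (W P Y × W P Y)} : mapSystem e T ⊆ S ↔ ∀ w w', (w, w') ∈ T → (e w, e w') ∈ S :=
  Set.image_subset_iff.trans Prod.forall

theorem mapSystem_mapSystem {Z : Finset X₀} (e : W P X → W P Y) (e' : W P Y → W P Z)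
    (T : Set (W P X × W P X)) : mapSystem e' (mapSystem e T) = mapSystem (e' ∘ e) T := by
  rw [mapSystem, mapSystem, mapSystem, ← Set.image_comp, Prod.map_comp_map]

/-- A bijection `e` of `W(X)` with `W(Y)` takes `H`-closures to `H'`-closures if every congruence
`Ker μ` with `μ : W(Y) → H'` pulls back along `e` to some `Ker (ρ μ)` with `ρ μ : W(X) → H`, and
every point of `Hom(W(X), H)` is of the form `ρ μ`. -/
theorem eqClosure_mapSystem {e : W P X → W P Y} (he : Function.Bijective e)
    (ρ : (W P Y →ₐ[P] H') → (W P X →ₐ[P] H)) (hρ : Function.Surjective ρ)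
    (h : ∀ μ w w', μ (e w) = μ (e w') ↔ ρ μ w = ρ μ w') (T : Set (W P X × W P X)) :
    eqClosure H' (mapSystem e T) = mapSystem e (eqClosure H T) := by
  have hz : ∀ μ, μ ∈ zeros H' (mapSystem e T) ↔ ρ μ ∈ zeros H T := fun μ => by
    simp only [zeros, mapSystem, Set.mem_ofPred_eq, Set.forall_mem_image, Prod.map_fst,
      Prod.map_snd, h]
  ext ⟨v, v'⟩
  obtain ⟨w, rfl⟩ := he.2 v
  obtain ⟨w', rfl⟩ := he.2 v'
  rw [mk_mem_mapSystem he.1]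
  refine ⟨fun hv μ hμ => ?_, fun hw μ hμ => (h μ w w').2 (hw _ ((hz μ).1 hμ))⟩
  obtain ⟨μ, rfl⟩ := hρ μ
  exact (h μ w w').1 (hv μ ((hz μ).2 hμ))

/-- The automorphism of the ring `W(X)` that applies `σ` to the coefficients. -/
noncomputable def coeffMap (σ : RingAut P) (X : Finset X₀) : W P X ≃+* W P X :=
  MvPolynomial.mapEquiv X σ

@[simp]
theorem coeffMap_C (σ : RingAut P) (c : P) :
    coeffMap σ X (MvPolynomial.C c) = MvPolynomial.C (σ c) :=
  MvPolynomial.map_C _ _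

@[simp]
theorem coeffMap_inv_apply (σ : RingAut P) (w : W P X) :
    coeffMap σ⁻¹ X (coeffMap σ X w) = w :=
  (coeffMap σ X).symm_apply_apply w

@[simp]
theorem coeffMap_apply_inv (σ : RingAut P) (w : W P X) :
    coeffMap σ X (coeffMap σ⁻¹ X w) = w :=
  (coeffMap σ X).apply_symm_apply w

/-- Applying `σ` to coefficients takes `H₁`-closures of systems of equations to `H₂`-closures. -/
def TwistsClosure {P : Type u} [Field P] (X₀ : Type w) (σ : RingAut P)
    (H₁ : Type*) [CommRing H₁] [Algebra P H₁] (H₂ : Type*) [CommRing H₂] [Algebra P H₂] : Prop :=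
  ∀ (X : Finset X₀) (T : Set (W P X × W P X)),
    eqClosure H₂ (mapSystem (coeffMap σ X) T) = mapSystem (coeffMap σ X) (eqClosure H₁ T)

theorem mapSystem_coeffMap_inv (σ : RingAut P) (T : Set (W P X × W P X)) :
    mapSystem (coeffMap σ⁻¹ X) (mapSystem (coeffMap σ X) T) = T := by
  have : coeffMap σ⁻¹ X ∘ coeffMap σ X = id := funext (coeffMap_inv_apply σ)
  rw [mapSystem_mapSystem, this, mapSystem, Prod.map_id, Set.image_id]

theorem mapSystem_coeffMap_apply_inv (σ : RingAut P) (T : Set (W P X × W P X)) :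
    mapSystem (coeffMap σ X) (mapSystem (coeffMap σ⁻¹ X) T) = T := by
  have : coeffMap σ X ∘ coeffMap σ⁻¹ X = id := funext (coeffMap_apply_inv σ)
  rw [mapSystem_mapSystem, this, mapSystem, Prod.map_id, Set.image_id]

theorem TwistsClosure.symm {σ : RingAut P} (h : TwistsClosure X₀ σ H H') :
    TwistsClosure X₀ σ⁻¹ H' H := fun X T => by
  conv_rhs => rw [← mapSystem_coeffMap_apply_inv σ T, h, mapSystem_coeffMap_inv]

/-- A `P`-homomorphism into `H^σ` is a ring homomorphism into `H` that becomes `P`-linear after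
twisting the coefficients of its argument. -/
theorem eqClosure_twist (σ : RingAut P) (T : Set (W P X × W P X)) :
    eqClosure (Twist σ H) (mapSystem (coeffMap σ X) T) =
      mapSystem (coeffMap σ X) (eqClosure H T) := by
  have hC : ∀ c, algebraMap P (Twist σ H) (σ c) = (algebraMap P H c : H) := fun c =>
    congrArg (algebraMap P H) (σ.symm_apply_apply c)
  let ρ : (W P X →ₐ[P] Twist σ H) → (W P X →ₐ[P] H) := fun μ =>
    { toRingHom := (show W P X →+* H from μ.toRingHom).comp (coeffMap σ X).toRingHom
      commutes' := fun c => by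
        change μ (coeffMap σ X (MvPolynomial.C c)) = _
        rw [coeffMap_C, ← hC]
        exact μ.commutes _ }
  refine eqClosure_mapSystem (coeffMap σ X).bijective ρ (fun μ => ?_)
    (fun μ w w' => Iff.rfl) T
  refine ⟨{ toRingHom := (show W P X →+* Twist σ H from
              (μ.toRingHom.comp (coeffMap σ⁻¹ X).toRingHom))
            commutes' := fun c => ?_ }, AlgHom.ext fun w => ?_⟩
  · change μ (coeffMap σ⁻¹ X (MvPolynomial.C c)) = _
    rw [coeffMap_C]
    exact μ.commutes _
  · change μ (coeffMap σ⁻¹ X (coeffMap σ X w)) = μ w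
    rw [coeffMap_inv_apply]

theorem twistedGeometricallyEquivalent_iff :
    TwistedGeometricallyEquivalent P X₀ H H' ↔ ∃ σ : RingAut P, TwistsClosure X₀ σ H H' := by
  refine exists_congr fun σ => forall_congr' fun X => ⟨fun h T => ?_, fun h T => ?_⟩
  · rw [← eqClosure_twist, h]
  · rw [← mapSystem_coeffMap_apply_inv σ T, eqClosure_twist, h]

end Galois

/-! ### Equivalences that are compatible with the affine space functors -/

section Equivalence

open MvPolynomial Opposite FreeAlg

variable {P : Type u} [Field P] {X₀ : Type w} {H : Type*} [CommRing H] [Algebra P H]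
  {H₁ : Type*} [CommRing H₁] [Algebra P H₁] {H₂ : Type*} [CommRing H₂] [Algebra P H₂]

theorem AlgebraicSet.hom_ext {A B : AlgebraicSet P X₀ H} {f g : A ⟶ B}
    (h : ∀ ν, (f.1 ν).1 = (g.1 ν).1) : f = g :=
  Subtype.ext (funext fun ν => Subtype.ext (h ν))

/-- The equations satisfied on the image of a morphism into an affine space. -/
def homEquations {A : AlgebraicSet P X₀ H} {a : FreeAlg P X₀}
    (k : A ⟶ (affine P X₀ H).obj (op a)) : Set (W P a.X × W P a.X) :=
  equations (Set.range fun ν => (k.1 ν).1)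

theorem mem_homEquations {A : AlgebraicSet P X₀ H} {a : FreeAlg P X₀}
    {k : A ⟶ (affine P X₀ H).obj (op a)} {p : W P a.X × W P a.X} :
    p ∈ homEquations k ↔ ∀ ν, (k.1 ν).1 p.1 = (k.1 ν).1 p.2 :=
  Set.forall_mem_range

theorem homEquations_subset_comp {A B : AlgebraicSet P X₀ H} {a : FreeAlg P X₀} (f : A ⟶ B)
    (k : B ⟶ (affine P X₀ H).obj (op a)) : homEquations k ⊆ homEquations (f ≫ k) :=
  fun _ hp => mem_homEquations.2 fun ν => mem_homEquations.1 hp (f.1 ν)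

/-- The equations on the image of `k` are detected by composing `k` with morphisms of affine
spaces. -/
theorem comp_affine_map_eq_iff {A : AlgebraicSet P X₀ H} {a b : FreeAlg P X₀}
    (k : A ⟶ (affine P X₀ H).obj (op a)) (s t : b ⟶ a) {u : W P b.X}
    (hu : ∀ f g : W P b.X →ₐ[P] H, f u = g u → f = g) :
    k ≫ (affine P X₀ H).map s.op = k ≫ (affine P X₀ H).map t.op ↔
      (toAlgHom s u, toAlgHom t u) ∈ homEquations k := by
  rw [mem_homEquations]
  constructor
  · intro h ν
    exact congrArg (fun f : A ⟶ (affine P X₀ H).obj (op b) => (f.1 ν).1 u) h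
  · intro h
    refine AlgebraicSet.hom_ext fun ν => ?_
    exact hu ((k.1 ν).1.comp (toAlgHom s)) ((k.1 ν).1.comp (toAlgHom t)) (h ν)

/-- The embedding of an algebraic set into its affine space. -/
def AlgebraicSet.embedding (a : FreeAlg P X₀) (T : Set (W P a.X × W P a.X)) :
    (⟨a.X, zeros H T, T, rfl⟩ : AlgebraicSet P X₀ H) ⟶ (affine P X₀ H).obj (op a) :=
  ⟨fun ν => ⟨ν.1, trivial⟩, AlgHom.id P _, fun _ => rfl⟩

theorem homEquations_embedding (a : FreeAlg P X₀) (T : Set (W P a.X × W P a.X)) :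
    homEquations (AlgebraicSet.embedding (H := H) a T) = eqClosure H T := by
  ext p
  rw [mem_homEquations]
  exact Subtype.forall

variable {φ : FreeAlg P X₀ ⥤ FreeAlg P X₀} [φ.IsEquivalence]
  {Φ : ∀ a : FreeAlg P X₀, W P a.X → W P (φ.obj a).X}

theorem IsElementMap.mem_homEquations_iff [Nonempty X₀] (h : IsElementMap φ Φ)
    (F : AlgebraicSet P X₀ H₁ ⥤ AlgebraicSet P X₀ H₂) [F.Faithful]
    (α : affine P X₀ H₁ ⋙ F ≅ φ.op ⋙ affine P X₀ H₂)
    {A : AlgebraicSet P X₀ H₁} {a : FreeAlg P X₀} (k : A ⟶ (affine P X₀ H₁).obj (op a))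
    (w w' : W P a.X) :
    (w, w') ∈ homEquations k ↔
      (Φ a w, Φ a w') ∈ homEquations (a := φ.obj a) (F.map k ≫ α.hom.app (op a)) := by
  obtain ⟨x⟩ := ‹Nonempty X₀›
  let I : FreeAlg P X₀ := ⟨{x}⟩
  let x' : I.X := ⟨x, Finset.mem_singleton_self x⟩
  have hsub : ∀ i : I.X, i = x' := fun i => Subtype.ext (Finset.mem_singleton.1 i.2)
  let ev (w : W P a.X) : I ⟶ a := ofAlgHom (aeval fun _ => w)
  have hev : ∀ w, toAlgHom (ev w) (X x') = w := fun w => aeval_X _ _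
  have e₁ := comp_affine_map_eq_iff k (ev w) (ev w') (u := X x')
    fun f g hfg => MvPolynomial.algHom_ext fun i => by rw [hsub i, hfg]
  have e₂ := comp_affine_map_eq_iff (a := φ.obj a) (F.map k ≫ α.hom.app (op a))
    (φ.map (ev w)) (φ.map (ev w')) (u := Φ I (X x'))
    fun f g hfg => h.algHom_ext fun i => by rw [hsub i, hfg]
  rw [← h.map_apply, ← h.map_apply, hev, hev] at e₂
  rw [hev, hev] at e₁
  have hnat : ∀ s : I ⟶ a, (F.map k ≫ α.hom.app (op a)) ≫ (affine P X₀ H₂).map (φ.map s).op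
      = F.map (k ≫ (affine P X₀ H₁).map s.op) ≫ α.hom.app (op I) := fun s => by
    have := α.hom.naturality s.op
    simp only [Functor.comp_map, Functor.op_map, Quiver.Hom.unop_op] at this
    rw [Category.assoc, F.map_comp, Category.assoc, this]
  rw [← e₁, ← e₂, hnat, hnat, cancel_mono, F.map_injective.eq_iff]

/-- An equivalence of the categories of algebraic sets which extends `φ` on affine spaces makes
closed congruences on `W(X)` and on `W(φ X)` correspond to each other: these are the
congruences of the form `homEquations k`. -/
theorem IsElementMap.eqClosure_mapSystem [Nonempty X₀] (h : IsElementMap φ Φ)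
    (F : AlgebraicSet P X₀ H₁ ⥤ AlgebraicSet P X₀ H₂) [F.IsEquivalence]
    (α : affine P X₀ H₁ ⋙ F ≅ φ.op ⋙ affine P X₀ H₂) (a : FreeAlg P X₀)
    (T : Set (W P a.X × W P a.X)) :
    eqClosure H₂ (mapSystem (Φ a) T) = mapSystem (Φ a) (eqClosure H₁ T) := by
  apply Set.Subset.antisymm
  -- the `H₁`-closure of `T` is given by the embedding of the solution set of `T`, and `F` sends it
  -- to a morphism whose congruence is `H₂`-closed
  · let k := AlgebraicSet.embedding (H := H₁) a T
    have key := h.mem_homEquations_iff F α k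
    rw [homEquations_embedding] at key
    rintro ⟨v, v'⟩ hv
    obtain ⟨w, rfl⟩ := (h.bijective a).2 v
    obtain ⟨w', rfl⟩ := (h.bijective a).2 v'
    rw [mk_mem_mapSystem (h.bijective a).1, key]
    refine eqClosure_subset_equations (mapSystem_subset_iff.2 fun w w' hw => ?_) hv
    exact (key w w').1 (subset_eqClosure T hw)
  -- conversely, the embedding of the solution set of `Φ T` comes from some `k` over `H₁`
  · let i := AlgebraicSet.embedding (H := H₂) (φ.obj a) (mapSystem (Φ a) T)
    let β := F.objObjPreimageIso ⟨(φ.obj a).X, zeros H₂ (mapSystem (Φ a) T), _, rfl⟩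
    let k : F.objPreimage _ ⟶ (affine P X₀ H₁).obj (op a) :=
      F.preimage (β.hom ≫ i ≫ α.inv.app (op a))
    have hk : F.map k ≫ α.hom.app (op a) = β.hom ≫ i := by
      rw [F.map_preimage, Category.assoc, Category.assoc, Iso.inv_hom_id_app]
      exact congrArg (β.hom ≫ ·) (Category.comp_id i)
    have hi : homEquations (a := φ.obj a) (F.map k ≫ α.hom.app (op a)) =
        eqClosure H₂ (mapSystem (Φ a) T) := by
      rw [← homEquations_embedding, hk]
      refine Set.Subset.antisymm ?_ (homEquations_subset_comp _ _)
      conv_rhs => rw [← Category.id_comp (AlgebraicSet.embedding _ _), ← β.inv_hom_id,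
        Category.assoc]
      exact homEquations_subset_comp _ _
    have key := h.mem_homEquations_iff F α k
    rw [hi] at key
    refine mapSystem_subset_iff.2 fun w w' hw => (key w w').1 ?_
    refine eqClosure_subset_equations (fun p hp => ?_) hw
    exact (key p.1 p.2).2 (subset_eqClosure _ ⟨p, hp, rfl⟩)

theorem twistedGeometricallyEquivalent_of_isEquivalence [Infinite P] [Infinite X₀]
    (F : AlgebraicSet P X₀ H₁ ⥤ AlgebraicSet P X₀ H₂) [F.IsEquivalence]
    (φ : FreeAlg P X₀ ⥤ FreeAlg P X₀) [φ.IsEquivalence]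
    (h : affine P X₀ H₁ ⋙ F = φ.op ⋙ affine P X₀ H₂) :
    TwistedGeometricallyEquivalent P X₀ H₁ H₂ := by
  obtain ⟨σ, Φ, hΦ, hC⟩ := exists_semilinear_isElementMap φ
  refine twistedGeometricallyEquivalent_iff.2 ⟨σ, fun X T => ?_⟩
  let a : FreeAlg P X₀ := ⟨X⟩
  -- `Φ` is the coefficient map followed by an isomorphism `ε` of `P`-algebras
  let ε : W P X ≃ₐ[P] W P (φ.obj a).X :=
    AlgEquiv.ofRingEquiv (f := (coeffMap σ X).symm.trans (Φ a)) fun c => by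
      change Φ a (coeffMap σ⁻¹ X (C c)) = C c
      rw [coeffMap_C]
      exact (hC a _).trans (congrArg C (σ.apply_symm_apply c))
  have hε : ∀ w, ε (coeffMap σ X w) = Φ a w := fun w =>
    congrArg (Φ a) ((coeffMap σ X).symm_apply_apply w)
  have hεS : ∀ T, mapSystem ε (mapSystem (coeffMap σ X) T) = mapSystem (Φ a) T := fun T => by
    rw [mapSystem_mapSystem, (funext hε : ε ∘ coeffMap σ X = Φ a)]
  have hinj : Function.Injective (mapSystem (P := P) ε) :=
    Set.image_injective.2 (ε.injective.prodMap ε.injective)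
  apply hinj
  have := ComAlgGeom.eqClosure_mapSystem (H := H₂) (H' := H₂) ε.bijective
    (fun μ => μ.comp ε.toAlgHom)
    (fun μ => ⟨μ.comp ε.symm.toAlgHom, by ext; simp⟩) (fun μ w w' => Iff.rfl)
  rw [← this, hεS, hεS]
  exact hΦ.eqClosure_mapSystem F (eqToIso h) a T

end Equivalence

/-! ### The isomorphism of categories given by twisting coefficients -/

section Twisting

open Opposite FreeAlg

variable {P : Type u} [Field P] {X₀ : Type w}

/-- The homomorphism `s` with its coefficients twisted by `σ`. -/
noncomputable def conjHom (σ : RingAut P) {X Y : Finset X₀} (s : W P X →ₐ[P] W P Y) :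
    W P X →ₐ[P] W P Y where
  toRingHom := (coeffMap σ Y).toRingHom.comp (s.toRingHom.comp (coeffMap σ⁻¹ X).toRingHom)
  commutes' c := by
    change coeffMap σ Y (s (coeffMap σ⁻¹ X (MvPolynomial.C c))) = _
    rw [coeffMap_C]
    refine (congrArg (coeffMap σ Y) (s.commutes _)).trans ?_
    refine (coeffMap_C σ _).trans ?_
    exact congrArg MvPolynomial.C (σ.apply_symm_apply c)

theorem conjHom_apply (σ : RingAut P) {X Y : Finset X₀} (s : W P X →ₐ[P] W P Y) (w : W P X) :
    conjHom σ s w = coeffMap σ Y (s (coeffMap σ⁻¹ X w)) :=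
  rfl

@[simp]
theorem conjHom_coeffMap (σ : RingAut P) {X Y : Finset X₀} (s : W P X →ₐ[P] W P Y) (w : W P X) :
    conjHom σ s (coeffMap σ X w) = coeffMap σ Y (s w) := by
  rw [conjHom_apply, coeffMap_inv_apply]

theorem conjHom_inv_conjHom (σ : RingAut P) {X Y : Finset X₀} (s : W P X →ₐ[P] W P Y) :
    conjHom σ⁻¹ (conjHom σ s) = s :=
  AlgHom.ext fun w => by
    rw [conjHom_apply, inv_inv, conjHom_coeffMap, coeffMap_inv_apply]

theorem conjHom_comp (σ : RingAut P) {X Y Z : Finset X₀} (s : W P Y →ₐ[P] W P Z)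
    (t : W P X →ₐ[P] W P Y) : conjHom σ (s.comp t) = (conjHom σ s).comp (conjHom σ t) :=
  AlgHom.ext fun w => by
    rw [AlgHom.comp_apply, conjHom_apply σ t, conjHom_coeffMap]
    rfl

/-- The automorphism of `Θ⁰` which twists the coefficients of homomorphisms by `σ`. -/
noncomputable def twistFree (σ : RingAut P) : FreeAlg P X₀ ⥤ FreeAlg P X₀ where
  obj a := a
  map s := ofAlgHom (conjHom σ (toAlgHom s))
  map_id _ := AlgHom.ext fun w => coeffMap_apply_inv σ w
  map_comp s t := conjHom_comp σ (toAlgHom t) (toAlgHom s)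

theorem twistFree_comp_inv (σ : RingAut P) :
    twistFree (X₀ := X₀) σ ⋙ twistFree σ⁻¹ = 𝟭 _ :=
  CategoryTheory.Functor.hext (fun _ => rfl) fun _ _ s =>
    heq_of_eq (conjHom_inv_conjHom σ (toAlgHom s))

variable {H : Type*} [CommRing H] [Algebra P H] {H' : Type*} [CommRing H'] [Algebra P H']

/-- The set of `H'`-solutions of the twisted equations of a set of `H`-points. -/
def twistPoints (σ : RingAut P) (H' : Type*) [CommRing H'] [Algebra P H'] {X : Finset X₀}
    (A : Set (W P X →ₐ[P] H)) : Set (W P X →ₐ[P] H') :=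
  zeros H' (mapSystem (coeffMap σ X) (equations A))

theorem mem_twistPoints {σ : RingAut P} {X : Finset X₀} {A : Set (W P X →ₐ[P] H)}
    {μ : W P X →ₐ[P] H'} : μ ∈ twistPoints σ H' A ↔
      ∀ w w', (w, w') ∈ equations A → μ (coeffMap σ X w) = μ (coeffMap σ X w') :=
  Set.forall_mem_image.trans Prod.forall

theorem twistPoints_mono (σ : RingAut P) {X : Finset X₀} {A B : Set (W P X →ₐ[P] H)}
    (h : A ⊆ B) : twistPoints σ H' A ⊆ twistPoints σ H' B :=
  fun _ hμ => mem_twistPoints.2 fun w w' hw =>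
    mem_twistPoints.1 hμ w w' fun ν hν => hw ν (h hν)

theorem TwistsClosure.twistPoints_univ {σ : RingAut P} (h : TwistsClosure X₀ σ H H')
    (X : Finset X₀) : twistPoints σ H' (Set.univ : Set (W P X →ₐ[P] H)) = Set.univ := by
  have e : (Set.univ : Set (W P X →ₐ[P] H)) = zeros H ∅ := by simp [zeros]
  rw [e, twistPoints]
  change zeros H' (mapSystem (coeffMap σ X) (eqClosure H ∅)) = _
  rw [← h, eqClosure, zeros_equations_zeros]
  simp [zeros, mapSystem]

theorem TwistsClosure.twistPoints_twistPoints {σ : RingAut P} (h : TwistsClosure X₀ σ H H')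
    {X : Finset X₀} {A : Set (W P X →ₐ[P] H)} (hA : ∃ T, A = zeros H T) :
    twistPoints σ⁻¹ H (twistPoints σ H' A) = A := by
  obtain ⟨T, rfl⟩ := hA
  have e : equations (twistPoints σ H' (zeros H T)) =
      mapSystem (coeffMap σ X) (equations (zeros H T)) := by
    change eqClosure H' _ = _
    rw [h, eqClosure_equations]
  rw [twistPoints, e, mapSystem_coeffMap_inv, zeros_equations_zeros]

theorem comp_conjHom_mem_twistPoints (σ : RingAut P) {X Y : Finset X₀}
    {A : Set (W P X →ₐ[P] H)} {B : Set (W P Y →ₐ[P] H)} {s : W P Y →ₐ[P] W P X}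
    (hs : ∀ ν ∈ A, ν.comp s ∈ B) {μ : W P X →ₐ[P] H'} (hμ : μ ∈ twistPoints σ H' A) :
    μ.comp (conjHom σ s) ∈ twistPoints σ H' B :=
  mem_twistPoints.2 fun w w' hw => by
    simp only [AlgHom.comp_apply, conjHom_coeffMap]
    exact mem_twistPoints.1 hμ _ _ fun ν hν => hw _ (hs ν hν)

theorem comp_conjHom_eq_comp_conjHom (σ : RingAut P) {X Y : Finset X₀}
    {A : Set (W P X →ₐ[P] H)} {s t : W P Y →ₐ[P] W P X}
    (hst : ∀ ν ∈ A, ν.comp s = ν.comp t) {μ : W P X →ₐ[P] H'} (hμ : μ ∈ twistPoints σ H' A) :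
    μ.comp (conjHom σ s) = μ.comp (conjHom σ t) :=
  AlgHom.ext fun v => mem_twistPoints.1 hμ _ _ fun ν hν =>
    DFunLike.congr_fun (hst ν hν) (coeffMap σ⁻¹ Y v)

theorem comp_hom_mem {A B : AlgebraicSet P X₀ H} {f : A ⟶ B} {s : W P B.X →ₐ[P] W P A.X}
    (hs : ∀ ν : A.carrier, (f.1 ν).1 = ν.1.comp s) : ∀ ν ∈ A.carrier, ν.comp s ∈ B.carrier :=
  fun ν hν => hs ⟨ν, hν⟩ ▸ (f.1 ⟨ν, hν⟩).2

/-- The functor which replaces an algebraic set by the set of solutions of its twisted equations,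
and a homomorphism `s` that induces a morphism by the twisted homomorphism. The result does not
depend on the choice of `s`. -/
noncomputable def twistFunctor (σ : RingAut P) (H : Type*) [CommRing H] [Algebra P H]
    (H' : Type*) [CommRing H'] [Algebra P H'] : AlgebraicSet P X₀ H ⥤ AlgebraicSet P X₀ H' where
  obj A := ⟨A.X, twistPoints σ H' A.carrier, _, rfl⟩
  map {A B} f := ⟨fun μ => ⟨μ.1.comp (conjHom σ f.2.choose),
    comp_conjHom_mem_twistPoints σ (comp_hom_mem f.2.choose_spec) μ.2⟩,
    conjHom σ f.2.choose, fun _ => rfl⟩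
  map_id A := AlgebraicSet.hom_ext fun μ => by
    have := comp_conjHom_eq_comp_conjHom σ (s := (𝟙 A : A ⟶ A).2.choose) (t := AlgHom.id P _)
      (fun ν hν => ((𝟙 A : A ⟶ A).2.choose_spec ⟨ν, hν⟩).symm) μ.2
    refine this.trans (AlgHom.ext fun w => ?_)
    exact congrArg μ.1 (coeffMap_apply_inv σ w)
  map_comp {A B C} f g := AlgebraicSet.hom_ext fun μ => by
    have := comp_conjHom_eq_comp_conjHom σ (s := (f ≫ g).2.choose)
      (t := f.2.choose.comp g.2.choose)
      (fun ν hν => by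
        rw [← (f ≫ g).2.choose_spec ⟨ν, hν⟩, ← AlgHom.comp_assoc, ← f.2.choose_spec ⟨ν, hν⟩,
          ← g.2.choose_spec]
        rfl) μ.2
    refine this.trans ?_
    rw [conjHom_comp]
    rfl

theorem twistFunctor_map_apply (σ : RingAut P) {A B : AlgebraicSet P X₀ H} (f : A ⟶ B)
    {s : W P B.X →ₐ[P] W P A.X} (hs : ∀ ν : A.carrier, (f.1 ν).1 = ν.1.comp s)
    (μ : twistPoints σ H' A.carrier) :
    (((twistFunctor σ H H').map f).1 μ).1 = μ.1.comp (conjHom σ s) :=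
  comp_conjHom_eq_comp_conjHom σ
    (fun ν hν => (f.2.choose_spec ⟨ν, hν⟩).symm.trans (hs ⟨ν, hν⟩)) μ.2

theorem twistFunctor_sub (σ : RingAut P) (A B : AlgebraicSet P X₀ H) (h : A.Sub B) :
    ((twistFunctor σ H H').obj A).Sub ((twistFunctor σ H H').obj B) := by
  obtain ⟨X, A₁, A₂, h₁, h₂, rfl, rfl, hsub⟩ := h
  exact ⟨X, _, _, ⟨_, rfl⟩, ⟨_, rfl⟩, rfl, rfl, twistPoints_mono σ hsub⟩

/-- Morphisms between equal algebraic sets are equal if the same homomorphism induces them. -/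
theorem AlgebraicSet.hom_heq {X Y : Finset X₀} {A A' : Set (W P X →ₐ[P] H)}
    {B B' : Set (W P Y →ₐ[P] H)} (hA : ∃ T, A = zeros H T) (hA' : ∃ T, A' = zeros H T)
    (hB : ∃ T, B = zeros H T) (hB' : ∃ T, B' = zeros H T) (eA : A = A') (eB : B = B')
    (f : (⟨X, A, hA⟩ : AlgebraicSet P X₀ H) ⟶ ⟨Y, B, hB⟩)
    (g : (⟨X, A', hA'⟩ : AlgebraicSet P X₀ H) ⟶ ⟨Y, B', hB'⟩) (s : W P Y →ₐ[P] W P X)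
    (hf : ∀ ν : A, (f.1 ν).1 = ν.1.comp s) (hg : ∀ ν : A', (g.1 ν).1 = ν.1.comp s) :
    HEq f g := by
  subst eA eB
  exact heq_of_eq (AlgebraicSet.hom_ext fun ν => (hf ν).trans (hg ν).symm)

theorem AlgebraicSet.ext_carrier {X : Finset X₀} {A A' : Set (W P X →ₐ[P] H)}
    (hA : ∃ T, A = zeros H T) (hA' : ∃ T, A' = zeros H T) (e : A = A') :
    (⟨X, A, hA⟩ : AlgebraicSet P X₀ H) = ⟨X, A', hA'⟩ := by
  subst e
  rfl

theorem TwistsClosure.twistFunctor_comp_inv {σ : RingAut P} (h : TwistsClosure X₀ σ H H') :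
    twistFunctor (X₀ := X₀) σ H H' ⋙ twistFunctor σ⁻¹ H' H = 𝟭 _ := by
  refine CategoryTheory.Functor.hext
    (fun A => AlgebraicSet.ext_carrier _ A.isAlgebraic (h.twistPoints_twistPoints A.isAlgebraic))
    fun A B f => ?_
  obtain ⟨s, hs⟩ := f.2
  refine AlgebraicSet.hom_heq _ A.isAlgebraic _ B.isAlgebraic
    (h.twistPoints_twistPoints A.isAlgebraic) (h.twistPoints_twistPoints B.isAlgebraic)
    _ f s (fun μ => ?_) hs
  refine (twistFunctor_map_apply σ⁻¹ (A := (twistFunctor σ H H').obj A)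
    (B := (twistFunctor σ H H').obj B) _ (twistFunctor_map_apply σ f hs) μ).trans ?_
  exact congrArg (AlgHom.comp μ.1) (conjHom_inv_conjHom σ s)

theorem TwistsClosure.affine_comp_twistFunctor {σ : RingAut P} (h : TwistsClosure X₀ σ H H') :
    affine P X₀ H ⋙ twistFunctor σ H H' = (twistFree σ).op ⋙ affine P X₀ H' := by
  refine CategoryTheory.Functor.hext
    (fun a => AlgebraicSet.ext_carrier _ _ (h.twistPoints_univ a.unop.X)) fun a b s => ?_
  refine AlgebraicSet.hom_heq _ _ _ _ (h.twistPoints_univ a.unop.X) (h.twistPoints_univ b.unop.X)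
    _ ((affine P X₀ H').map ((twistFree σ).op.map s)) (conjHom σ (toAlgHom s.unop))
    (fun μ => ?_) fun μ => rfl
  exact twistFunctor_map_apply σ ((affine P X₀ H).map s) (fun ν => rfl) μ

variable {H₁ : Type*} [CommRing H₁] [Algebra P H₁] {H₂ : Type*} [CommRing H₂] [Algebra P H₂]

theorem TwistsClosure.correctlyIsomorphic {σ : RingAut P} (h : TwistsClosure X₀ σ H₁ H₂) :
    CorrectlyIsomorphic P X₀ H₁ H₂ :=
  ⟨twistFunctor σ H₁ H₂, twistFunctor σ⁻¹ H₂ H₁, h.twistFunctor_comp_inv,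
    h.symm.twistFunctor_comp_inv, ⟨twistFree σ, twistFree σ⁻¹, twistFree_comp_inv σ,
      twistFree_comp_inv σ⁻¹, h.affine_comp_twistFunctor⟩, twistFunctor_sub σ⟩

theorem TwistsClosure.correctlyEquivalent {σ : RingAut P} (h : TwistsClosure X₀ σ H₁ H₂) :
    CorrectlyEquivalent P X₀ H₁ H₂ :=
  ⟨twistFunctor σ H₁ H₂, twistFunctor σ⁻¹ H₂ H₁, ⟨eqToIso h.twistFunctor_comp_inv⟩,
    ⟨eqToIso h.symm.twistFunctor_comp_inv⟩, ⟨twistFree σ, twistFree σ⁻¹,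
      ⟨eqToIso (twistFree_comp_inv σ)⟩, ⟨eqToIso (twistFree_comp_inv σ⁻¹)⟩,
      h.affine_comp_twistFunctor, h.symm.affine_comp_twistFunctor⟩,
    twistFunctor_sub σ, twistFunctor_sub σ⁻¹⟩

theorem CorrectlyIsomorphic.twistedGeometricallyEquivalent [Infinite P] [Infinite X₀]
    (h : CorrectlyIsomorphic P X₀ H₁ H₂) : TwistedGeometricallyEquivalent P X₀ H₁ H₂ := by
  obtain ⟨F, G, hFG, hGF, ⟨φ, ψ, hφψ, hψφ, hφ⟩, -⟩ := h
  have : F.IsEquivalence :=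
    (CategoryTheory.Equivalence.mk F G (eqToIso hFG.symm) (eqToIso hGF)).isEquivalence_functor
  have : φ.IsEquivalence :=
    (CategoryTheory.Equivalence.mk φ ψ (eqToIso hφψ.symm) (eqToIso hψφ)).isEquivalence_functor
  exact twistedGeometricallyEquivalent_of_isEquivalence F φ hφ

theorem CorrectlyEquivalent.twistedGeometricallyEquivalent [Infinite P] [Infinite X₀]
    (h : CorrectlyEquivalent P X₀ H₁ H₂) : TwistedGeometricallyEquivalent P X₀ H₁ H₂ := by
  obtain ⟨F, G, ⟨hFG⟩, ⟨hGF⟩, ⟨φ, ψ, ⟨hφψ⟩, ⟨hψφ⟩, hφ, -⟩, -⟩ := h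
  have : F.IsEquivalence :=
    (CategoryTheory.Equivalence.mk F G hFG.symm hGF).isEquivalence_functor
  have : φ.IsEquivalence :=
    (CategoryTheory.Equivalence.mk φ ψ hφψ.symm hψφ).isEquivalence_functor
  exact twistedGeometricallyEquivalent_of_isEquivalence F φ hφ

end Twisting

end ComAlgGeom

theorem theorem4 {P : Type*} [Field P] [Infinite P] (X₀ : Type*) [Infinite X₀]
    (H₁ : Type*) [CommRing H₁] [Algebra P H₁] (H₂ : Type*) [CommRing H₂] [Algebra P H₂] :
    List.TFAE [
      ComAlgGeom.CorrectlyIsomorphic P X₀ H₁ H₂,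
      ComAlgGeom.CorrectlyEquivalent P X₀ H₁ H₂,
      ComAlgGeom.TwistedGeometricallyEquivalent P X₀ H₁ H₂] := by
  tfae_have 1 → 3 := fun h => h.twistedGeometricallyEquivalent
  tfae_have 2 → 3 := fun h => h.twistedGeometricallyEquivalent
  tfae_have 3 → 1 := fun h => by
    obtain ⟨σ, hσ⟩ := ComAlgGeom.twistedGeometricallyEquivalent_iff.1 h
    exact hσ.correctlyIsomorphic
  tfae_have 3 → 2 := fun h => by
    obtain ⟨σ, hσ⟩ := ComAlgGeom.twistedGeometricallyEquivalent_iff.1 h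
    exact hσ.correctlyEquivalent
  tfae_finish
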